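/- **Lemma 4.1.** Let $U, W \subset \mathbb{C}$ be open discs with $0 \in W$, let $s \ge 1$, and let $a_0(t,\varepsilon), \dots, a_{n-1}(t,\varepsilon)$ be holomorphic on the polydisc $U \times W$. Suppose that the linear differential equation in $t$, with parameter $\varepsilon$, $$\varepsilon^s y^{(n)} + a_{n-1}(t,\varepsilon)\, y^{(n-1)} + \dots + a_0(t,\varepsilon)\, y = 0 \qquad (*)$$ is singularly perturbed, that is, $a_k(\cdot,0) \not\equiv 0$ on $U$ for some $k$, $0 \le k \le n-1$. Then there is a discrete subset $D \subset U$ (with no accumulation point in $U$) such that for every $t_0 \in U \setminus D$ there exists a solution $y(t,\varepsilon)$ of $(*)$, holomorphic on $U \times (W \setminus \{0\})$, with the following two properties (derivatives are with respect to $t$): 1. the initial data $y(t_0,\varepsilon), y'(t_0,\varepsilon), \dots, y^{(n-1)}(t_0,\varepsilon)$ do not depend on $\varepsilon \in W \setminus \{0\}$; 2. there is an at most countable set $E \subset U$ such that for every $t_1 \in U \setminus E$ the function $\varepsilon \mapsto y(t_1,\varepsilon)$ has an essential singularity at $\varepsilon = 0$. -/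

import Mathlib

open Topology Filter

/-- The family of linear differential equations
`ε ^ s * y⁽ⁿ⁾ + a_{n-1}(t, ε) * y⁽ⁿ⁻¹⁾ + ⋯ + a_0(t, ε) * y = 0`, with coefficients holomorphic on
`U × W`, is singularly perturbed: `s ≥ 1`, and some coefficient `a_k(·, 0)`, `0 ≤ k ≤ n - 1`, is not
identically zero on `U`. -/
structure IsSingularlyPerturbed {n : ℕ} (s : ℕ) (a : Fin n → ℂ → ℂ → ℂ) (U W : Set ℂ) : Prop where
  one_le : 1 ≤ s
  holomorphic : ∀ i, DifferentiableOn ℂ (fun p : ℂ × ℂ => a i p.1 p.2) (U ×ˢ W)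
  exists_ne_zero : ∃ k, ∃ t ∈ U, a k t 0 ≠ 0

/-- `y(t, ε)` is a parameter dependent solution, jointly holomorphic in `(t, ε) ∈ U × V`, of
`ε ^ s * y⁽ⁿ⁾ + a_{n-1}(t, ε) * y⁽ⁿ⁻¹⁾ + ⋯ + a_0(t, ε) * y = 0`; the derivatives are taken with
respect to `t`. The set `U × V` is meant to be open. -/
structure IsParamSolution {n : ℕ} (s : ℕ) (a : Fin n → ℂ → ℂ → ℂ) (U V : Set ℂ)
    (y : ℂ → ℂ → ℂ) : Prop where
  holomorphic : DifferentiableOn ℂ (fun p : ℂ × ℂ => y p.1 p.2) (U ×ˢ V)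
  equation : ∀ t ∈ U, ∀ ε ∈ V,
    ε ^ s * iteratedDeriv n (fun τ => y τ ε) t
      + ∑ i : Fin n, a i t ε * iteratedDeriv (i : ℕ) (fun τ => y τ ε) t = 0

/-- `f` has an essential singularity at `z₀`: it is holomorphic in a punctured neighbourhood of
`z₀`, and the isolated singularity at `z₀` is neither removable nor a pole. -/
def HasEssentialSingularityAt (f : ℂ → ℂ) (z₀ : ℂ) : Prop :=
  (∀ᶠ z in 𝓝[≠] z₀, DifferentiableAt ℂ f z) ∧ ¬ MeromorphicAt f z₀

/-!
Off `ε = 0` the equation is a linear system with coefficients holomorphic in `(t, ε)`, so initial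
data at `t₀` independent of `ε` are those of a holomorphic solution `y`. Let `a_m(·, 0)` be the last
coefficient that is not identically zero, let `a_m(t₀, 0) ≠ 0`, and prescribe `y⁽ⁱ⁾(t₀) = δ_{im}`.

Suppose that the Laurent expansion of `y` in `ε` has only finitely many terms of negative order.
Since `s ≥ 1`, its lowest nonvanishing coefficient `y_k(t)` solves the limit equation
`∑ i ≤ m, a_i(t, 0) u⁽ⁱ⁾ = 0`. If `k < 0`, the initial data of `y_k` at `t₀` vanish because those of
`y` do not depend on `ε`, whence `y_k = 0`, a contradiction. If there are no terms of negative
order, then `y_0` satisfies the limit equation, which its initial data rule out at `t₀`. Hence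
`y_k ≠ 0` for infinitely many `k < 0`, and each of these `y_k` has at most countably many zeros.
-/

section ParametricHolomorphy

open Set Metric

variable {E : Type*} [NormedAddCommGroup E] [NormedSpace ℂ E]

theorem differentiableOn_slice_left {f : ℂ × ℂ → E} {U V : Set ℂ}
    (hf : DifferentiableOn ℂ f (U ×ˢ V)) {w : ℂ} (hw : w ∈ V) :
    DifferentiableOn ℂ (fun z => f (z, w)) U :=
  hf.comp (f := fun z => (z, w)) (by fun_prop) fun _ hz => ⟨hz, hw⟩

theorem differentiableOn_slice_right {f : ℂ × ℂ → E} {U V : Set ℂ}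
    (hf : DifferentiableOn ℂ f (U ×ˢ V)) {z : ℂ} (hz : z ∈ U) :
    DifferentiableOn ℂ (fun w => f (z, w)) V :=
  hf.comp (f := fun w => (z, w)) (by fun_prop) fun _ hw => ⟨hz, hw⟩

theorem tendstoLocallyUniformlyOn_slice_left {ι F : Type*} [UniformSpace F] {l : Filter ι}
    {g : ι → ℂ × ℂ → F} {f : ℂ × ℂ → F} {U V : Set ℂ}
    (h : TendstoLocallyUniformlyOn g f l (U ×ˢ V)) {w : ℂ} (hw : w ∈ V) :
    TendstoLocallyUniformlyOn (fun i z => g i (z, w)) (fun z => f (z, w)) l U :=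
  h.comp (fun z => (z, w)) (fun _ hz => ⟨hz, hw⟩) (by fun_prop)

theorem tendstoLocallyUniformlyOn_slice_right {ι F : Type*} [UniformSpace F] {l : Filter ι}
    {g : ι → ℂ × ℂ → F} {f : ℂ × ℂ → F} {U V : Set ℂ}
    (h : TendstoLocallyUniformlyOn g f l (U ×ˢ V)) {z : ℂ} (hz : z ∈ U) :
    TendstoLocallyUniformlyOn (fun i w => g i (z, w)) (fun w => f (z, w)) l V :=
  h.comp (fun w => (z, w)) (fun _ hw => ⟨hz, hw⟩) (by fun_prop)

theorem continuousOn_intervalIntegral_of_continuousOn_prod {X F : Type*} [TopologicalSpace X]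
    [NormedAddCommGroup F] [NormedSpace ℝ F] {S : Set X} {a b : ℝ}
    {f : X → ℝ → F} (hf : ContinuousOn (Function.uncurry f) (S ×ˢ uIcc a b)) :
    ContinuousOn (fun p => ∫ x in a..b, f p x) S := by
  rw [continuousOn_iff_continuous_domRestrict]
  have extended : Continuous fun p : S =>
      ∫ x in a..b, f p (projIcc (a ⊓ b) (a ⊔ b) inf_le_sup x) := by
    refine intervalIntegral.continuous_parametric_intervalIntegral_of_continuous' ?_ a b
    exact hf.comp_continuous
      (f := fun q : S × ℝ => ((q.1 : X), (projIcc (a ⊓ b) (a ⊔ b) inf_le_sup q.2 : ℝ)))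
      (by fun_prop) fun q => ⟨q.1.2, (projIcc _ _ inf_le_sup q.2).2⟩
  refine extended.congr fun p => intervalIntegral.integral_congr fun x hx => ?_
  simp only [projIcc_of_mem inf_le_sup hx]

variable [CompleteSpace E]

theorem continuousOn_deriv_of_continuousOn_uncurry {X : Type*} [TopologicalSpace X]
    {S : Set X} {Ω : Set ℂ} (hΩ : IsOpen Ω) {f : X → ℂ → E}
    (hf : ContinuousOn (Function.uncurry f) (S ×ˢ Ω)) (hd : ∀ x ∈ S, DifferentiableOn ℂ (f x) Ω) :
    ContinuousOn (fun p : X × ℂ => deriv (f p.1) p.2) (S ×ˢ Ω) := by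
  rintro ⟨x₀, z₀⟩ ⟨hx₀, hz₀⟩
  have hfst : Tendsto (Prod.fst : X × ℂ → X) (𝓝[S ×ˢ Ω] (x₀, z₀)) (𝓝[S] x₀) := by
    rw [nhdsWithin_prod_eq]; exact tendsto_fst
  have hsnd : Tendsto (Prod.snd : X × ℂ → ℂ) (𝓝[S ×ˢ Ω] (x₀, z₀)) (𝓝[Ω] z₀) := by
    rw [nhdsWithin_prod_eq]; exact tendsto_snd
  have hlim : TendstoLocallyUniformlyOn (fun p : X × ℂ => f p.1) (f x₀)
      (𝓝[S ×ˢ Ω] (x₀, z₀)) Ω := by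
    rw [tendstoLocallyUniformlyOn_iff_forall_isCompact hΩ]
    intro K hKΩ hK u hu
    obtain ⟨v, hv, hvu⟩ := hK.mem_uniformity_of_prod
      (hf.mono (prod_mono_right hKΩ)) hx₀ (symm_le_uniformity hu)
    filter_upwards [hfst hv] with p hp x hx
    exact hvu p.1 hp x hx
  have hev : ∀ᶠ p : X × ℂ in 𝓝[S ×ˢ Ω] (x₀, z₀), DifferentiableOn ℂ (f p.1) Ω := by
    filter_upwards [self_mem_nhdsWithin] with p hp using hd p.1 hp.1
  exact (hlim.deriv hev hΩ).tendsto_comp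
    (((hd x₀ hx₀).deriv hΩ).continuousOn z₀ hz₀) hz₀ hsnd

theorem differentiableOn_prod_of_separately {U V : Set ℂ} (hU : IsOpen U) (hV : IsOpen V)
    {f : ℂ × ℂ → E} (hf : ContinuousOn f (U ×ˢ V))
    (hleft : ∀ w ∈ V, DifferentiableOn ℂ (fun z => f (z, w)) U)
    (hright : ∀ z ∈ U, DifferentiableOn ℂ (fun w => f (z, w)) V) :
    DifferentiableOn ℂ f (U ×ˢ V) := by
  have cright : ContinuousOn (fun p : ℂ × ℂ => deriv (fun w => f (p.1, w)) p.2) (U ×ˢ V) :=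
    continuousOn_deriv_of_continuousOn_uncurry (f := fun z w => f (z, w)) hV hf hright
  have hswap : ContinuousOn (Function.uncurry fun w z => f (z, w)) (V ×ˢ U) :=
    hf.comp continuous_swap.continuousOn fun p hp => ⟨hp.2, hp.1⟩
  have cleft : ContinuousOn (fun p : ℂ × ℂ => deriv (fun z => f (z, p.2)) p.1) (U ×ˢ V) :=
    (continuousOn_deriv_of_continuousOn_uncurry (f := fun w z => f (z, w)) hU hswap hleft).comp
      continuous_swap.continuousOn fun p hp => ⟨hp.2, hp.1⟩
  intro p hp
  have hmem : U ×ˢ V ∈ 𝓝 p := (hU.prod hV).mem_nhds hp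
  have hspan := (ContinuousLinearMap.toSpanSingletonCLE (𝕜 := ℂ) (E := E)).continuous
  refine (hasStrictFDerivAt_uncurry_coprod (𝕜 := ℂ) (f := fun z w => f (z, w))
    (f₁ := fun z w => ContinuousLinearMap.toSpanSingleton ℂ (deriv (fun z => f (z, w)) z))
    (f₂ := fun z w => ContinuousLinearMap.toSpanSingleton ℂ (deriv (fun w => f (z, w)) w))
    (u := p) ?_ ?_ ?_ ?_).hasFDerivAt.differentiableAt.differentiableWithinAt
  · filter_upwards [hmem] with q hq
    exact ((hleft q.2 hq.2).differentiableAt (hU.mem_nhds hq.1)).hasDerivAt.hasFDerivAt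
  · filter_upwards [hmem] with q hq
    exact ((hright q.1 hq.1).differentiableAt (hV.mem_nhds hq.2)).hasDerivAt.hasFDerivAt
  · exact hspan.continuousAt.comp (cleft.continuousAt hmem)
  · exact hspan.continuousAt.comp (cright.continuousAt hmem)

theorem differentiableOn_prod_of_tendstoLocallyUniformlyOn {ι : Type*} {l : Filter ι} [l.NeBot]
    {F : ι → ℂ × ℂ → E} {f : ℂ × ℂ → E} {U V : Set ℂ} (hU : IsOpen U) (hV : IsOpen V)
    (hlim : TendstoLocallyUniformlyOn F f l (U ×ˢ V))
    (hF : ∀ i, DifferentiableOn ℂ (F i) (U ×ˢ V)) : DifferentiableOn ℂ f (U ×ˢ V) := by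
  refine differentiableOn_prod_of_separately hU hV
    (hlim.continuousOn (.of_forall fun i => (hF i).continuousOn)) (fun w hw => ?_) fun z hz => ?_
  · exact (tendstoLocallyUniformlyOn_slice_left hlim hw).differentiableOn
      (.of_forall fun i => differentiableOn_slice_left (hF i) hw) hU
  · exact (tendstoLocallyUniformlyOn_slice_right hlim hz).differentiableOn
      (.of_forall fun i => differentiableOn_slice_right (hF i) hz) hV

theorem hasDerivAt_intervalIntegral_of_differentiableOn {Ω : Set ℂ} (hΩ : IsOpen Ω) {a b : ℝ}
    {F : ℂ → ℝ → E} (hF : ContinuousOn (Function.uncurry fun x z => F z x) (uIcc a b ×ˢ Ω))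
    (hd : ∀ x ∈ uIcc a b, DifferentiableOn ℂ (fun z => F z x) Ω) {z₀ : ℂ} (hz₀ : z₀ ∈ Ω) :
    HasDerivAt (fun z => ∫ x in a..b, F z x) (∫ x in a..b, deriv (fun z => F z x) z₀) z₀ := by
  have hcont := continuousOn_deriv_of_continuousOn_uncurry (f := fun x z => F z x) hΩ hF hd
  obtain ⟨δ, hδ, hδΩ⟩ := nhds_basis_closedBall.mem_iff.1 (hΩ.mem_nhds hz₀)
  obtain ⟨M, hM⟩ := (isCompact_uIcc.prod (isCompact_closedBall z₀ δ)).exists_bound_of_continuousOn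
    (hcont.mono (prod_mono_right hδΩ))
  have hslice : ∀ z ∈ Ω, ContinuousOn (F z) (uIcc a b) := fun z hz =>
    hF.comp (f := fun x => (x, z)) (by fun_prop) fun x hx => ⟨hx, hz⟩
  have hslice' : ContinuousOn (fun x => deriv (fun z => F z x) z₀) (uIcc a b) :=
    hcont.comp (f := fun x => (x, z₀)) (by fun_prop) fun x hx => ⟨hx, hz₀⟩
  refine (intervalIntegral.hasDerivAt_integral_of_dominated_loc_of_deriv_le
    (F' := fun z x => deriv (fun z => F z x) z) (bound := fun _ => M)
    (closedBall_mem_nhds z₀ hδ) ?_ (hslice z₀ hz₀).intervalIntegrable ?_ ?_ ?_ ?_).2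
  · filter_upwards [hΩ.mem_nhds hz₀] with z hz
    exact ((hslice z hz).mono uIoc_subset_uIcc).aestronglyMeasurable measurableSet_uIoc
  · exact (hslice'.mono uIoc_subset_uIcc).aestronglyMeasurable measurableSet_uIoc
  · exact .of_forall fun x hx z hz => hM (x, z) ⟨uIoc_subset_uIcc hx, hz⟩
  · exact intervalIntegrable_const
  · exact .of_forall fun x hx z hz =>
      ((hd x (uIoc_subset_uIcc hx)).differentiableAt (hΩ.mem_nhds (hδΩ hz))).hasDerivAt

end ParametricHolomorphy

/-- The integral of `f` along the segment from `t₀` to `t`: the primitive of a holomorphic `f` that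
vanishes at `t₀`, on any domain that is star-shaped about `t₀`. -/
noncomputable def segmentIntegral {E : Type*} [NormedAddCommGroup E] [NormedSpace ℂ E]
    (t₀ : ℂ) (f : ℂ → E) (t : ℂ) : E :=
  ∫ x in (0 : ℝ)..1, (t - t₀) • f (t₀ + x • (t - t₀))

section SegmentIntegral

open Set Metric

variable {E : Type*} [NormedAddCommGroup E] [NormedSpace ℂ E] {t₀ : ℂ} {U V : Set ℂ}

@[simp]
theorem segmentIntegral_self (f : ℂ → E) : segmentIntegral t₀ f t₀ = 0 := by
  simp [segmentIntegral]

theorem norm_segmentIntegral_le {f : ℂ → E} {B : ℝ} {k : ℕ} {t : ℂ}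
    (hf : ∀ x ∈ Icc (0 : ℝ) 1, ‖f (t₀ + x • (t - t₀))‖ ≤ B * x ^ k) :
    ‖segmentIntegral t₀ f t‖ ≤ ‖t - t₀‖ * B / (k + 1) := by
  have integrand_le : ∀ x ∈ Ioc (0 : ℝ) 1,
      ‖(t - t₀) • f (t₀ + x • (t - t₀))‖ ≤ ‖t - t₀‖ * B * x ^ k := fun x hx => by
    rw [norm_smul, mul_assoc]
    gcongr
    exact hf x ⟨hx.1.le, hx.2⟩
  refine (intervalIntegral.norm_integral_le_of_norm_le zero_le_one (.of_forall integrand_le)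
    (Continuous.intervalIntegrable (by fun_prop) _ _)).trans_eq ?_
  rw [intervalIntegral.integral_const_mul, integral_pow]
  simp [div_eq_mul_inv]

theorem continuousOn_comp_segment_prod {F : Type*} [TopologicalSpace F] (hU : StarConvex ℝ t₀ U)
    {f : ℂ × ℂ → F} (hf : ContinuousOn f (U ×ˢ V)) :
    ContinuousOn (fun q : (ℂ × ℂ) × ℝ => f (t₀ + q.2 • (q.1.1 - t₀), q.1.2))
      ((U ×ˢ V) ×ˢ Icc (0 : ℝ) 1) :=
  hf.comp (f := fun q : (ℂ × ℂ) × ℝ => (t₀ + q.2 • (q.1.1 - t₀), q.1.2)) (by fun_prop)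
    fun _ hq => ⟨hU.add_smul_sub_mem hq.1.1 hq.2.1 hq.2.2, hq.1.2⟩

theorem hasDerivAt_segmentIntegrand {f : ℂ → E} {f' : E} {x : ℝ} {t : ℂ}
    (hf : HasDerivAt f f' (t₀ + x • (t - t₀))) :
    HasDerivAt (fun z => (z - t₀) • f (t₀ + x • (z - t₀)))
      ((t - t₀) • x • f' + f (t₀ + x • (t - t₀))) t := by
  have hγ : HasDerivAt (fun z => t₀ + x • (z - t₀)) (x : ℂ) t := by
    simpa using (((hasDerivAt_id t).sub_const t₀).const_smul x).const_add t₀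
  simpa using! ((hasDerivAt_id t).sub_const t₀).smul (hf.scomp t hγ)

-- The derivative in `x` agrees with that of the integrand in `t`, so the fundamental theorem of
-- calculus evaluates the differentiated segment integral.
theorem hasDerivAt_smul_comp_segment {f : ℂ → E} {f' : E} {x : ℝ} {t : ℂ}
    (hf : HasDerivAt f f' (t₀ + x • (t - t₀))) :
    HasDerivAt (fun x : ℝ => x • f (t₀ + x • (t - t₀)))
      ((t - t₀) • x • f' + f (t₀ + x • (t - t₀))) x := by
  have hγ : HasDerivAt (fun x : ℝ => t₀ + x • (t - t₀)) (t - t₀) x := by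
    simpa using ((hasDerivAt_id x).smul_const (t - t₀)).const_add t₀
  simpa [smul_comm x (t - t₀)] using! (hasDerivAt_id x).smul (hf.scomp x hγ)

variable [CompleteSpace E]

theorem hasDerivAt_segmentIntegral (hU : IsOpen U) (hU₀ : StarConvex ℝ t₀ U) {f : ℂ → E}
    (hf : DifferentiableOn ℂ f U) {t : ℂ} (ht : t ∈ U) :
    HasDerivAt (segmentIntegral t₀ f) (f t) t := by
  have hmem : ∀ z ∈ U, ∀ x ∈ uIcc (0 : ℝ) 1, t₀ + x • (z - t₀) ∈ U := fun z hz x hx => by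
    rw [uIcc_of_le zero_le_one] at hx
    exact hU₀.add_smul_sub_mem hz hx.1 hx.2
  have hfd : ∀ z ∈ U, ∀ x ∈ uIcc (0 : ℝ) 1,
      HasDerivAt f (deriv f (t₀ + x • (z - t₀))) (t₀ + x • (z - t₀)) := fun z hz x hx =>
    (hf.differentiableAt (hU.mem_nhds (hmem z hz x hx))).hasDerivAt
  have hcont : ContinuousOn (Function.uncurry fun (x : ℝ) z => (z - t₀) • f (t₀ + x • (z - t₀)))
      (uIcc 0 1 ×ˢ U) := ContinuousOn.smul (by fun_prop) (hf.continuousOn.comp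
        (f := fun q : ℝ × ℂ => t₀ + q.1 • (q.2 - t₀)) (by fun_prop) fun q hq => hmem _ hq.2 _ hq.1)
  have hcont' : ContinuousOn (fun x : ℝ => (t - t₀) • x • deriv f (t₀ + x • (t - t₀))
      + f (t₀ + x • (t - t₀))) (uIcc 0 1) := by
    have hγ : ContinuousOn (fun x : ℝ => t₀ + x • (t - t₀)) (uIcc 0 1) := by fun_prop
    exact .add (continuousOn_const.smul
      (continuousOn_id.smul ((hf.deriv hU).continuousOn.comp hγ (hmem t ht))))
      (hf.continuousOn.comp hγ (hmem t ht))
  refine (hasDerivAt_intervalIntegral_of_differentiableOn hU hcont (fun x hx z hz =>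
    (hasDerivAt_segmentIntegrand (hfd z hz x hx)).differentiableAt.differentiableWithinAt)
    ht).congr_deriv ?_
  rw [intervalIntegral.integral_congr fun x hx =>
      (hasDerivAt_segmentIntegrand (hfd t ht x hx)).deriv,
    intervalIntegral.integral_eq_sub_of_hasDerivAt
      (fun x hx => hasDerivAt_smul_comp_segment (hfd t ht x hx)) hcont'.intervalIntegrable]
  simp

theorem differentiableOn_segmentIntegral_prod (hU : IsOpen U) (hU₀ : StarConvex ℝ t₀ U)
    (hV : IsOpen V) {f : ℂ × ℂ → E} (hf : DifferentiableOn ℂ f (U ×ˢ V)) :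
    DifferentiableOn ℂ (fun p : ℂ × ℂ => segmentIntegral t₀ (fun τ => f (τ, p.2)) p.1)
      (U ×ˢ V) := by
  have hint : ContinuousOn (fun q : (ℂ × ℂ) × ℝ =>
      (q.1.1 - t₀) • f (t₀ + q.2 • (q.1.1 - t₀), q.1.2)) ((U ×ˢ V) ×ˢ uIcc 0 1) := by
    rw [uIcc_of_le zero_le_one]
    exact ContinuousOn.smul (by fun_prop) (continuousOn_comp_segment_prod hU₀ hf.continuousOn)
  refine differentiableOn_prod_of_separately hU hV
    (continuousOn_intervalIntegral_of_continuousOn_prod hint) (fun w hw z hz => ?_)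
    fun z hz w hw => ?_
  · exact (hasDerivAt_segmentIntegral hU hU₀ (differentiableOn_slice_left hf hw)
      hz).differentiableAt.differentiableWithinAt
  · refine (hasDerivAt_intervalIntegral_of_differentiableOn (a := 0) (b := 1)
      (F := fun w x => (z - t₀) • f (t₀ + x • (z - t₀), w)) hV ?_ (fun x hx => ?_)
      hw).differentiableAt.differentiableWithinAt
    · exact hint.comp (f := fun q : ℝ × ℂ => ((z, q.2), q.1)) (by fun_prop)
        fun q hq => ⟨⟨hz, hq.2⟩, hq.1⟩
    · rw [uIcc_of_le zero_le_one] at hx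
      exact (differentiableOn_slice_right hf
        (hU₀.add_smul_sub_mem hz hx.1 hx.2)).const_smul (z - t₀)

end SegmentIntegral

/-- The `k`-th term of the Neumann series of the linear system `Z' = A Z`, `Z t₀ = v`: its partial
sums are the Picard iterates. -/
noncomputable def picardTerm {E : Type*} [NormedAddCommGroup E] [NormedSpace ℂ E]
    (A : ℂ → E →L[ℂ] E) (t₀ : ℂ) (v : E) : ℕ → ℂ → E
  | 0 => fun _ => v
  | k + 1 => segmentIntegral t₀ fun t => A t (picardTerm A t₀ v k t)

section LinearSystem

open Set Metric

variable {E : Type*} [NormedAddCommGroup E] [NormedSpace ℂ E] {t₀ : ℂ} {U V : Set ℂ}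

theorem tsum_picardTerm_self (A : ℂ → E →L[ℂ] E) (v : E) :
    ∑' k, picardTerm A t₀ v k t₀ = v := by
  refine (tsum_eq_single 0 fun k hk => ?_).trans rfl
  obtain ⟨k, rfl⟩ := Nat.exists_eq_succ_of_ne_zero hk
  exact segmentIntegral_self _

theorem norm_picardTerm_le {A : ℂ → E →L[ℂ] E} {M : ℝ} {t : ℂ}
    (hM : ∀ x ∈ Icc (0 : ℝ) 1, ‖A (t₀ + x • (t - t₀))‖ ≤ M) (v : E) (k : ℕ) :
    ‖picardTerm A t₀ v k t‖ ≤ ‖v‖ * ((M * ‖t - t₀‖) ^ k / k.factorial) := by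
  have hM0 : 0 ≤ M := (norm_nonneg _).trans (hM 0 (left_mem_Icc.2 zero_le_one))
  induction k generalizing t with
  | zero => simp [picardTerm]
  | succ k ih =>
    refine (norm_segmentIntegral_le (k := k)
      (B := M * (‖v‖ * ((M * ‖t - t₀‖) ^ k / k.factorial))) fun x hx => ?_).trans_eq ?_
    · have hsub : ∀ x' ∈ Icc (0 : ℝ) 1,
          ‖A (t₀ + x' • (t₀ + x • (t - t₀) - t₀))‖ ≤ M := fun x' hx' => by
        rw [add_sub_cancel_left, smul_smul]
        exact hM _ (unitInterval.mul_mem hx' hx)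
      calc ‖A (t₀ + x • (t - t₀)) (picardTerm A t₀ v k (t₀ + x • (t - t₀)))‖
          ≤ M * (‖v‖ * ((M * ‖t₀ + x • (t - t₀) - t₀‖) ^ k / k.factorial)) :=
            (ContinuousLinearMap.le_opNorm _ _).trans
              (mul_le_mul (hM x hx) (ih hsub) (norm_nonneg _) hM0)
        _ = M * (‖v‖ * ((M * ‖t - t₀‖) ^ k / k.factorial)) * x ^ k := by
            rw [add_sub_cancel_left, norm_smul, Real.norm_of_nonneg hx.1]
            ring
    · rw [Nat.factorial_succ]
      push_cast
      field_simp
      ring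

variable {A : ℂ × ℂ → E →L[ℂ] E}

theorem exists_summable_norm_picardTerm_le (hU₀ : StarConvex ℝ t₀ U)
    (hA : ContinuousOn A (U ×ˢ V)) (v : E) {K : Set (ℂ × ℂ)} (hKU : K ⊆ U ×ˢ V)
    (hK : IsCompact K) :
    ∃ u : ℕ → ℝ, Summable u ∧
      ∀ k, ∀ p ∈ K, ‖picardTerm (fun τ => A (τ, p.2)) t₀ v k p.1‖ ≤ u k := by
  obtain ⟨M, hM⟩ := (hK.prod (isCompact_Icc (a := (0 : ℝ)) (b := 1))).exists_bound_of_continuousOn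
    ((continuousOn_comp_segment_prod hU₀ hA).mono (prod_mono_left hKU))
  obtain ⟨T, hT⟩ := hK.exists_bound_of_continuousOn
    (f := fun p : ℂ × ℂ => p.1 - t₀) (by fun_prop)
  have hsum : Summable fun k : ℕ => ‖v‖ * ((M * T) ^ k / k.factorial) :=
    (Real.summable_pow_div_factorial _).mul_left _
  refine ⟨_, hsum, fun k p hp => ?_⟩
  have hM' : ∀ x ∈ Icc (0 : ℝ) 1, ‖A (t₀ + x • (p.1 - t₀), p.2)‖ ≤ M := fun x hx =>
    hM (p, x) ⟨hp, hx⟩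
  have hM0 : 0 ≤ M := (norm_nonneg _).trans (hM' 0 (left_mem_Icc.2 zero_le_one))
  refine (norm_picardTerm_le (A := fun τ => A (τ, p.2)) hM' v k).trans ?_
  gcongr
  exact hT p hp

variable [CompleteSpace E]

theorem differentiableOn_picardTerm_prod (hU : IsOpen U) (hU₀ : StarConvex ℝ t₀ U)
    (hV : IsOpen V) (hA : DifferentiableOn ℂ A (U ×ˢ V)) (v : E) (k : ℕ) :
    DifferentiableOn ℂ (fun p : ℂ × ℂ => picardTerm (fun τ => A (τ, p.2)) t₀ v k p.1)
      (U ×ˢ V) := by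
  induction k with
  | zero => exact differentiableOn_const v
  | succ k ih =>
    exact differentiableOn_segmentIntegral_prod hU hU₀ hV
      (f := fun p => A p (picardTerm (fun τ => A (τ, p.2)) t₀ v k p.1)) (hA.clm_apply ih)

theorem hasDerivAt_sum_picardTerm (hU : IsOpen U) (hU₀ : StarConvex ℝ t₀ U) {B : ℂ → E →L[ℂ] E}
    (hB : DifferentiableOn ℂ B U) (v : E) (N : ℕ) {t : ℂ} (ht : t ∈ U) :
    HasDerivAt (fun t => ∑ k ∈ Finset.range (N + 1), picardTerm B t₀ v k t)
      (B t (∑ k ∈ Finset.range N, picardTerm B t₀ v k t)) t := by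
  have hterm : ∀ k, DifferentiableOn ℂ (picardTerm B t₀ v k) U := fun k => by
    induction k with
    | zero => exact differentiableOn_const v
    | succ k ih => exact fun t ht => (hasDerivAt_segmentIntegral hU hU₀
        (hB.clm_apply ih) ht).differentiableAt.differentiableWithinAt
  simp only [Finset.sum_range_succ', map_sum]
  exact (HasDerivAt.fun_sum fun k _ =>
    hasDerivAt_segmentIntegral hU hU₀ (hB.clm_apply (hterm k)) ht).add_const v

theorem tendstoLocallyUniformlyOn_sum_picardTerm (hU : IsOpen U) (hU₀ : StarConvex ℝ t₀ U)
    (hV : IsOpen V) (hA : ContinuousOn A (U ×ˢ V)) (v : E) :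
    TendstoLocallyUniformlyOn
      (fun N p => ∑ k ∈ Finset.range N, picardTerm (fun τ => A (τ, p.2)) t₀ v k p.1)
      (fun p => ∑' k, picardTerm (fun τ => A (τ, p.2)) t₀ v k p.1) atTop (U ×ˢ V) := by
  refine (tendstoLocallyUniformlyOn_iff_forall_isCompact (hU.prod hV)).2 fun K hKU hK => ?_
  obtain ⟨u, hu, hle⟩ := exists_summable_norm_picardTerm_le hU₀ hA v hKU hK
  exact tendstoUniformlyOn_tsum_nat hu hle

theorem exists_differentiableOn_linear_system (hU : IsOpen U) (hU₀ : StarConvex ℝ t₀ U)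
    (hV : IsOpen V) (hA : DifferentiableOn ℂ A (U ×ˢ V)) (v : E) :
    ∃ Z : ℂ × ℂ → E, DifferentiableOn ℂ Z (U ×ˢ V) ∧ (∀ ε ∈ V, Z (t₀, ε) = v) ∧
      ∀ t ∈ U, ∀ ε ∈ V, HasDerivAt (fun τ => Z (τ, ε)) (A (t, ε) (Z (t, ε))) t := by
  have hlim := tendstoLocallyUniformlyOn_sum_picardTerm hU hU₀ hV hA.continuousOn v
  have hZ := differentiableOn_prod_of_tendstoLocallyUniformlyOn hU hV hlim fun N =>
    .fun_sum fun k _ => differentiableOn_picardTerm_prod hU hU₀ hV hA v k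
  refine ⟨_, hZ, fun ε _ => tsum_picardTerm_self _ v, fun t ht ε hε => ?_⟩
  have hlimε := tendstoLocallyUniformlyOn_slice_left hlim hε
  have hsum := fun N τ (hτ : τ ∈ U) =>
    hasDerivAt_sum_picardTerm hU hU₀ (differentiableOn_slice_left hA hε) v N hτ
  have hlimε' := ((tendsto_add_atTop_iff_nat 1).2 (hlimε.deriv (.of_forall fun N τ hτ =>
    DifferentiableWithinAt.fun_sum fun k _ => differentiableOn_slice_left
      (differentiableOn_picardTerm_prod hU hU₀ hV hA v k) hε τ hτ) hU |>.tendsto_at ht)).congr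
        fun N => (hsum N t ht).deriv
  rw [← tendsto_nhds_unique hlimε'
    (((A (t, ε)).continuous.tendsto _).comp (hlimε.tendsto_at ht))]
  exact ((differentiableOn_slice_left hZ hε).differentiableAt (hU.mem_nhds ht)).hasDerivAt

end LinearSystem

section ScalarEquation

open Set Metric

variable {n : ℕ} {U V : Set ℂ}

theorem eqOn_iteratedDeriv_of_hasDerivAt_succ (hU : IsOpen U) {Z : Fin (n + 1) → ℂ → ℂ}
    (hZ : ∀ i : Fin n, ∀ t ∈ U, HasDerivAt (Z i.castSucc) (Z i.succ t) t) (i : Fin (n + 1)) :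
    EqOn (iteratedDeriv i (Z 0)) (Z i) U := by
  induction i using Fin.induction with
  | zero => exact fun t _ => congrFun iteratedDeriv_zero t
  | succ i ih =>
    intro t ht
    rw [Fin.val_succ, iteratedDeriv_succ]
    exact (ih.eventuallyEq_of_mem (hU.mem_nhds ht)).deriv_eq.trans (hZ i t ht).deriv

/-- The matrix of the first order system for `(y, y', …, y⁽ⁿ⁾)` that is equivalent to
`y⁽ⁿ⁺¹⁾ = ∑ j, b j * y⁽ʲ⁾`. -/
noncomputable def companion (b : Fin (n + 1) → ℂ) : (Fin (n + 1) → ℂ) →L[ℂ] (Fin (n + 1) → ℂ) :=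
  ContinuousLinearMap.pi (Fin.lastCases 0 fun i => ContinuousLinearMap.proj i.succ) +
    ∑ j, b j • (ContinuousLinearMap.single ℂ (fun _ => ℂ) (Fin.last n)).comp
      (ContinuousLinearMap.proj j)

theorem companion_apply_castSucc (b v : Fin (n + 1) → ℂ) (i : Fin n) :
    companion b v i.castSucc = v i.succ := by
  simp [companion, i.castSucc_ne_last]

theorem companion_apply_last (b v : Fin (n + 1) → ℂ) :
    companion b v (Fin.last n) = ∑ j, b j * v j := by
  simp [companion]

theorem exists_differentiableOn_linear_ode (hU : IsOpen U) {t₀ : ℂ} (hU₀ : StarConvex ℝ t₀ U)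
    (hV : IsOpen V) {b : Fin n → ℂ × ℂ → ℂ} (hb : ∀ i, DifferentiableOn ℂ (b i) (U ×ˢ V))
    (ht₀ : t₀ ∈ U) (v : Fin n → ℂ) :
    ∃ y : ℂ × ℂ → ℂ, DifferentiableOn ℂ y (U ×ˢ V) ∧
      (∀ ε ∈ V, ∀ i : Fin n, iteratedDeriv i (fun t => y (t, ε)) t₀ = v i) ∧
      ∀ t ∈ U, ∀ ε ∈ V, iteratedDeriv n (fun τ => y (τ, ε)) t =
        ∑ i : Fin n, b i (t, ε) * iteratedDeriv i (fun τ => y (τ, ε)) t := by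
  cases n with
  | zero => exact ⟨0, by simp⟩
  | succ n =>
  have hcomp : DifferentiableOn ℂ (fun p => companion fun i => b i p) (U ×ˢ V) :=
    .const_add _ (.fun_sum fun j _ => (hb j).smul_const _)
  obtain ⟨Z, hZ, hZ₀, hZ'⟩ := exists_differentiableOn_linear_system hU hU₀ hV hcomp v
  have hderiv : ∀ t ∈ U, ∀ ε ∈ V, ∀ i, HasDerivAt (fun τ => Z (τ, ε) i)
      (companion (fun i => b i (t, ε)) (Z (t, ε)) i) t := fun t ht ε hε =>
    hasDerivAt_pi.1 (hZ' t ht ε hε)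
  have hiter : ∀ ε ∈ V, ∀ i : Fin (n + 1),
      EqOn (iteratedDeriv i fun τ => Z (τ, ε) 0) (fun t => Z (t, ε) i) U := fun ε hε i =>
    eqOn_iteratedDeriv_of_hasDerivAt_succ hU (Z := fun i t => Z (t, ε) i)
      (fun i t ht => by simpa only [companion_apply_castSucc] using hderiv t ht ε hε i.castSucc) i
  refine ⟨fun p => Z p 0, differentiableOn_pi.1 hZ 0, fun ε hε i => ?_, fun t ht ε hε => ?_⟩
  · exact (hiter ε hε i ht₀).trans (congrFun (hZ₀ ε hε) i)
  · have hlast : deriv (iteratedDeriv n fun τ => Z (τ, ε) 0) t =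
        companion (fun i => b i (t, ε)) (Z (t, ε)) (Fin.last n) :=
      ((hiter ε hε (Fin.last n)).eventuallyEq_of_mem (hU.mem_nhds ht)).deriv_eq.trans
        (hderiv t ht ε hε (Fin.last n)).deriv
    rw [iteratedDeriv_succ, hlast, companion_apply_last]
    exact Finset.sum_congr rfl fun i _ => congrArg _ (hiter ε hε i ht).symm

theorem exists_isParamSolution {s : ℕ} {a : Fin n → ℂ → ℂ → ℂ} (hU : IsOpen U) {t₀ : ℂ}
    (hU₀ : StarConvex ℝ t₀ U) (hV : IsOpen V) (hV₀ : ∀ ε ∈ V, ε ≠ 0)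
    (ha : ∀ i, DifferentiableOn ℂ (fun p : ℂ × ℂ => a i p.1 p.2) (U ×ˢ V)) (ht₀ : t₀ ∈ U)
    (v : Fin n → ℂ) :
    ∃ y : ℂ → ℂ → ℂ, IsParamSolution s a U V y ∧
      ∀ ε ∈ V, ∀ i : Fin n, iteratedDeriv (i : ℕ) (fun t => y t ε) t₀ = v i := by
  have hpow : ∀ p ∈ U ×ˢ V, p.2 ^ s ≠ 0 := fun p hp => pow_ne_zero s (hV₀ p.2 hp.2)
  obtain ⟨y, hy, hy₀, hy'⟩ := exists_differentiableOn_linear_ode hU hU₀ hV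
    (b := fun i p => -(a i p.1 p.2 * (p.2 ^ s)⁻¹))
    (fun i => ((ha i).fun_mul ((differentiableOn_snd.fun_pow s).fun_inv hpow)).fun_neg) ht₀ v
  refine ⟨fun t ε => y (t, ε), ⟨hy, fun t ht ε hε => ?_⟩, hy₀⟩
  rw [hy' t ht ε hε, Finset.mul_sum, ← Finset.sum_add_distrib]
  refine Finset.sum_eq_zero fun i _ => ?_
  field_simp [hpow (t, ε) ⟨ht, hε⟩]
  ring

end ScalarEquation

section AnalyticUniqueness

open Set

section Zeros

variable {f : ℂ → ℂ} {U : Set ℂ}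

theorem eventually_codiscreteWithin_ne_zero (hU : IsOpen U) (hU' : IsPreconnected U)
    (hf : DifferentiableOn ℂ f U) (h : ∃ t ∈ U, f t ≠ 0) :
    ∀ᶠ t in codiscreteWithin U, f t ≠ 0 :=
  ((hf.analyticOnNhd hU).eqOn_zero_or_eventually_ne_zero_of_preconnected hU').resolve_left
    fun h0 => let ⟨_, ht, hne⟩ := h; hne (h0 ht)

theorem not_accPt_zeros (hU : IsOpen U) (hU' : IsPreconnected U) (hf : DifferentiableOn ℂ f U)
    (h : ∃ t ∈ U, f t ≠ 0) : ∀ t ∈ U, ¬ AccPt t (𝓟 {t ∈ U | f t = 0}) := fun t ht hacc =>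
  mem_codiscreteWithin_accPt.1 (eventually_codiscreteWithin_ne_zero hU hU' hf h) t ht
    (hacc.mono (principal_mono.2 fun _ hx => ⟨hx.1, fun hne => hne hx.2⟩))

theorem countable_zeros (hU : IsOpen U) (hU' : IsPreconnected U) (hf : DifferentiableOn ℂ f U)
    (h : ∃ t ∈ U, f t ≠ 0) : {t ∈ U | f t = 0}.Countable := by
  have hd : IsDiscrete (U ∩ {t | f t = 0}) :=
    inter_comm _ U ▸
      isDiscrete_of_codiscreteWithin (eventually_codiscreteWithin_ne_zero hU hU' hf h)
  exact (HereditarilyLindelofSpace.isLindelof _).countable_of_isDiscrete hd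

end Zeros

variable {𝕜 : Type*} [NontriviallyNormedField 𝕜]

theorem le_analyticOrderAt_sum {E ι : Type*} [NormedAddCommGroup E] [NormedSpace 𝕜 E]
    (s : Finset ι) {f : ι → 𝕜 → E} {z : 𝕜} {N : ℕ∞} (h : ∀ i ∈ s, N ≤ analyticOrderAt (f i) z) :
    N ≤ analyticOrderAt (∑ i ∈ s, f i) z :=
  Finset.sum_induction f (fun g => N ≤ analyticOrderAt g z)
    (fun _ _ hf hg => (le_min hf hg).trans le_analyticOrderAt_add)
    (by simp [analyticOrderAt_eq_top.2]) h

variable [CharZero 𝕜] [CompleteSpace 𝕜] {u : 𝕜 → 𝕜} {z : 𝕜}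

theorem natCast_le_analyticOrderAt_iteratedDeriv_iff (hu : AnalyticAt 𝕜 u z) {i : ℕ}
    (h0 : ∀ j < i, iteratedDeriv j u z = 0) {N : ℕ} :
    N ≤ analyticOrderAt (iteratedDeriv i u) z ↔ (N + i : ℕ) ≤ analyticOrderAt u z := by
  induction i generalizing N with
  | zero => simp
  | succ i ih =>
    have hui : AnalyticAt 𝕜 (iteratedDeriv i u) z := by
      rw [iteratedDeriv_eq_iterate]; exact hu.iterated_deriv i
    rw [iteratedDeriv_succ, analyticOrderAt_deriv_ge_iff hui (h0 i i.lt_succ_self),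
      ← Nat.cast_succ, ih fun j hj => h0 j (hj.trans i.lt_succ_self), Nat.succ_add_eq_add_succ]

theorem eventually_eq_zero_of_linear_ode {n : ℕ} {b : Fin n → 𝕜 → 𝕜} (hu : AnalyticAt 𝕜 u z)
    (hb : ∀ i, AnalyticAt 𝕜 (b i) z) {m : Fin n} (hm : b m z ≠ 0)
    (hgt : ∀ i, m < i → b i =ᶠ[𝓝 z] 0)
    (hode : ∀ᶠ t in 𝓝 z, ∑ i : Fin n, b i t * iteratedDeriv i u t = 0)
    (hinit : ∀ i < (m : ℕ), iteratedDeriv i u z = 0) : u =ᶠ[𝓝 z] 0 := by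
  have hui (i : ℕ) : AnalyticAt 𝕜 (iteratedDeriv i u) z := by
    rw [iteratedDeriv_eq_iterate]; exact hu.iterated_deriv i
  -- The lower order terms vanish to higher order than `u⁽ᵐ⁾`, which the equation then improves.
  have horder : ∀ N : ℕ, (N + m : ℕ) ≤ analyticOrderAt u z := by
    intro N
    induction N with
    | zero => exact (natCast_le_analyticOrderAt_iteratedDeriv_iff hu hinit).1 (by simp)
    | succ N ih =>
    have hrest : (N + 1 : ℕ) ≤
        analyticOrderAt (∑ i ∈ Finset.univ.erase m, b i * iteratedDeriv i u) z := by
      refine le_analyticOrderAt_sum _ fun i hi => ?_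
      rw [analyticOrderAt_mul (hb i) (hui i)]
      obtain hlt | hlt := (Finset.ne_of_mem_erase hi).lt_or_gt
      · refine le_add_left ((natCast_le_analyticOrderAt_iteratedDeriv_iff hu
          fun j hj => hinit j (hj.trans hlt)).2 (le_trans ?_ ih))
        exact_mod_cast (by omega : N + 1 + (i : ℕ) ≤ N + m)
      · simp [analyticOrderAt_eq_top.2 (hgt i hlt)]
    have hsolve : ∑ i ∈ Finset.univ.erase m, b i * iteratedDeriv i u =ᶠ[𝓝 z]
        -(b m * iteratedDeriv m u) := by
      filter_upwards [hode] with t ht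
      rw [← Finset.add_sum_erase _ _ (Finset.mem_univ m)] at ht
      simpa using (neg_eq_of_add_eq_zero_right ht).symm
    rwa [analyticOrderAt_congr hsolve, analyticOrderAt_neg, analyticOrderAt_mul (hb m) (hui m),
      (hb m).analyticOrderAt_eq_zero.2 hm, zero_add,
      natCast_le_analyticOrderAt_iteratedDeriv_iff hu hinit] at hrest
  exact analyticOrderAt_eq_top.1 (ENat.eq_top_iff_forall_ge.2 fun N =>
    le_trans (by exact_mod_cast N.le_add_right m) (horder N))

end AnalyticUniqueness

/-- The coefficient of `z ^ m` in the Laurent expansion of `f` at `0`, given by Cauchy's formula on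
the circle of radius `ρ`. It depends on `ρ` unless `f` is holomorphic on a punctured disc of radius
greater than `ρ`. -/
noncomputable def laurentCoeff {E : Type*} [NormedAddCommGroup E] [NormedSpace ℂ E] (ρ : ℝ)
    (f : ℂ → E) (m : ℤ) : E :=
  (2 * Real.pi * Complex.I)⁻¹ • ∮ z in C(0, ρ), z ^ (-m - 1) • f z

section LaurentCoeff

open Set Metric

variable {E : Type*} [NormedAddCommGroup E] [NormedSpace ℂ E] {f g : ℂ → E} {ρ : ℝ}

theorem continuousOn_zpow_smul_sphere (hρ : 0 < ρ) (hf : ContinuousOn f (sphere 0 ρ)) (k : ℤ) :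
    ContinuousOn (fun z => z ^ k • f z) (sphere 0 ρ) :=
  (continuousOn_id.zpow₀ k fun _ hz => .inl (ne_of_mem_sphere hz hρ.ne')).smul hf

theorem circleIntegrable_zpow_smul (hρ : 0 < ρ) (hf : ContinuousOn f (sphere 0 ρ)) (k : ℤ) :
    CircleIntegrable (fun z => z ^ k • f z) 0 ρ :=
  (continuousOn_zpow_smul_sphere hρ hf k).circleIntegrable hρ.le

theorem laurentCoeff_congr (hρ : 0 ≤ ρ) (h : EqOn f g (sphere 0 ρ)) (m : ℤ) :
    laurentCoeff ρ f m = laurentCoeff ρ g m :=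
  congrArg _ (circleIntegral.integral_congr hρ fun _ hz => congrArg _ (h hz))

theorem laurentCoeff_const [CompleteSpace E] (hρ : 0 < ρ) (c : E) (m : ℤ) :
    laurentCoeff ρ (fun _ => c) m = if m = 0 then c else 0 := by
  rw [laurentCoeff, circleIntegral.integral_smul_const]
  split_ifs with hm
  · have hinv := circleIntegral.integral_sub_center_inv 0 hρ.ne'
    simp only [sub_zero] at hinv
    simp only [hm, neg_zero, zero_sub, zpow_neg_one, hinv]
    exact inv_smul_smul₀ Complex.two_pi_I_ne_zero c
  · have hzpow := circleIntegral.integral_sub_zpow_of_ne (n := -m - 1) (by omega) 0 0 ρ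
    simp only [sub_zero] at hzpow
    simp [hzpow]

theorem laurentCoeff_zpow_smul (hρ : 0 < ρ) (f : ℂ → E) (k m : ℤ) :
    laurentCoeff ρ (fun z => z ^ k • f z) m = laurentCoeff ρ f (m - k) := by
  refine congrArg _ (circleIntegral.integral_congr hρ.le fun z hz => ?_)
  simp only [smul_smul, ← zpow_add₀ (ne_of_mem_sphere hz hρ.ne')]
  congr 2
  ring

theorem laurentCoeff_add (hρ : 0 < ρ) (hf : ContinuousOn f (sphere 0 ρ))
    (hg : ContinuousOn g (sphere 0 ρ)) (m : ℤ) :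
    laurentCoeff ρ (fun z => f z + g z) m = laurentCoeff ρ f m + laurentCoeff ρ g m := by
  simp only [laurentCoeff, smul_add, circleIntegral.integral_add
    (circleIntegrable_zpow_smul hρ hf _) (circleIntegrable_zpow_smul hρ hg _)]

theorem laurentCoeff_sum {ι : Type*} (s : Finset ι) {f : ι → ℂ → E} (hρ : 0 < ρ)
    (hf : ∀ i ∈ s, ContinuousOn (f i) (sphere 0 ρ)) (m : ℤ) :
    laurentCoeff ρ (fun z => ∑ i ∈ s, f i z) m = ∑ i ∈ s, laurentCoeff ρ (f i) m := by
  simp only [laurentCoeff, Finset.smul_sum, circleIntegral.integral_fun_sum fun i hi =>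
    circleIntegrable_zpow_smul hρ (hf i hi) (-m - 1)]

theorem laurentCoeff_const_smul (c : ℂ) (f : ℂ → E) (m : ℤ) :
    laurentCoeff ρ (fun z => c • f z) m = c • laurentCoeff ρ f m := by
  simp only [laurentCoeff, smul_comm _ c, circleIntegral.integral_smul]

theorem tendsto_laurentCoeff {ι : Type*} {l : Filter ι} [l.IsCountablyGenerated] {F : ι → ℂ → E}
    (hρ : 0 < ρ) (hF : ∀ᶠ i in l, ContinuousOn (F i) (sphere 0 ρ))
    (hf : ContinuousOn f (sphere 0 ρ)) (h : TendstoUniformlyOn F f l (sphere 0 ρ)) (m : ℤ) :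
    Tendsto (fun i => laurentCoeff ρ (F i) m) l (𝓝 (laurentCoeff ρ f m)) := by
  have hzpow : ContinuousOn (fun z : ℂ => z ^ (-m - 1)) (sphere 0 ρ) := by
    simpa using continuousOn_zpow_smul_sphere hρ (continuousOn_const (c := (1 : ℂ))) (-m - 1)
  have hunif : TendstoUniformlyOn (fun i z => z ^ (-m - 1) • F i z) (fun z => z ^ (-m - 1) • f z)
      l (sphere 0 ρ) := by
    rw [← tendstoLocallyUniformlyOn_iff_tendstoUniformlyOn_of_compact (isCompact_sphere 0 ρ)]
    exact (TendstoUniformlyOn.tendstoLocallyUniformlyOn fun v hv =>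
      .of_forall fun _ z _ => refl_mem_uniformity hv).fun_smul₀ h.tendstoLocallyUniformlyOn hzpow hf
  exact (hunif.tendsto_circleIntegral_of_continuousOn hρ.le
    (hF.mono fun i hi => continuousOn_zpow_smul_sphere hρ hi _)).const_smul _

theorem tendsto_sum_coeff_smul_laurentCoeff {h : ℂ → ℂ} {p : FormalMultilinearSeries ℂ ℂ ℂ}
    {r : ENNReal} (hρ : 0 < ρ) (hρr : ENNReal.ofReal ρ < r) (hp : HasFPowerSeriesOnBall h p 0 r)
    (hf : ContinuousOn f (sphere 0 ρ)) (m : ℤ) :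
    Tendsto (fun n => ∑ k ∈ Finset.range n, p.coeff k • laurentCoeff ρ f (m - k)) atTop
      (𝓝 (laurentCoeff ρ (fun z => h z • f z) m)) := by
  have hsub : sphere (0 : ℂ) ρ ⊆ eball 0 r := fun z hz => by
    simpa [edist_dist, mem_sphere.1 hz] using hρr
  have hpart : TendstoLocallyUniformlyOn p.partialSum h atTop (sphere 0 ρ) := by
    simpa only [zero_add] using hp.tendstoLocallyUniformlyOn.mono hsub
  have hh : ContinuousOn h (sphere 0 ρ) := hp.continuousOn.mono hsub
  have hunif : TendstoUniformlyOn (fun n z => p.partialSum n z • f z) (fun z => h z • f z) atTop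
      (sphere 0 ρ) := by
    rw [← tendstoLocallyUniformlyOn_iff_tendstoUniformlyOn_of_compact (isCompact_sphere 0 ρ)]
    exact hpart.fun_smul₀ (TendstoUniformlyOn.tendstoLocallyUniformlyOn fun v hv =>
      .of_forall fun _ z _ => refl_mem_uniformity hv) hh hf
  have hterm : ∀ n z, p.partialSum n z • f z =
      ∑ k ∈ Finset.range n, p.coeff k • z ^ (k : ℤ) • f z := fun n z => by
    simp only [FormalMultilinearSeries.partialSum, Finset.sum_smul, zpow_natCast,
      FormalMultilinearSeries.apply_eq_pow_smul_coeff, smul_eq_mul, mul_comm (z ^ _), mul_smul]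
  have hcoeff : ∀ n, laurentCoeff ρ (fun z => p.partialSum n z • f z) m =
      ∑ k ∈ Finset.range n, p.coeff k • laurentCoeff ρ f (m - k) := fun n => by
    simp only [hterm]
    rw [laurentCoeff_sum (f := fun k z => p.coeff k • z ^ (k : ℤ) • f z) _ hρ
      fun k _ => (continuousOn_zpow_smul_sphere hρ hf k).const_smul _]
    simp only [laurentCoeff_const_smul, laurentCoeff_zpow_smul hρ]
  exact (tendsto_laurentCoeff hρ (.of_forall fun n => (p.partialSum_continuous n).continuousOn.smul
    hf) (hh.smul hf) hunif m).congr hcoeff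

theorem laurentCoeff_smul_of_forall_lt {h : ℂ → ℂ} {p : FormalMultilinearSeries ℂ ℂ ℂ}
    {r : ENNReal} (hρ : 0 < ρ) (hρr : ENNReal.ofReal ρ < r) (hp : HasFPowerSeriesOnBall h p 0 r)
    (hf : ContinuousOn f (sphere 0 ρ)) {m : ℤ} (hm : ∀ k < m, laurentCoeff ρ f k = 0) :
    laurentCoeff ρ (fun z => h z • f z) m = h 0 • laurentCoeff ρ f m := by
  refine tendsto_nhds_unique (tendsto_sum_coeff_smul_laurentCoeff hρ hρr hp hf m)
    (tendsto_const_nhds.congr' ?_)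
  filter_upwards [eventually_gt_atTop 0] with n hn
  rw [Finset.sum_eq_single_of_mem 0 (Finset.mem_range.2 hn) fun k _ hk => by
    rw [hm _ (by omega), smul_zero]]
  have hcoeff : p.coeff 0 = h 0 := hp.coeff_zero _
  simp [hcoeff]

theorem exists_forall_lt_laurentCoeff_eq_zero (hρ : 0 < ρ)
    (hf : DifferentiableOn ℂ f (closedBall 0 ρ \ {0})) (hmer : MeromorphicAt f 0) :
    ∃ N : ℤ, ∀ m < N, laurentCoeff ρ f m = 0 := by
  obtain ⟨N, hN⟩ := hmer
  simp only [sub_zero] at hN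
  refine ⟨-N, fun m hm => ?_⟩
  obtain ⟨j, hj⟩ : ∃ j : ℕ, -m - 1 = (j + N : ℕ) := ⟨(-m - 1 - N).toNat, by omega⟩
  have hdiff : DifferentiableOn ℂ (fun z => z ^ j • z ^ N • f z) (closedBall 0 ρ) := by
    intro z hz
    obtain rfl | hz₀ := eq_or_ne z 0
    · exact ((differentiableAt_pow j).smul hN.differentiableAt).differentiableWithinAt
    · have hfz : DifferentiableWithinAt ℂ f (closedBall 0 ρ) z :=
        (hf z ⟨hz, hz₀⟩).mono_of_mem_nhdsWithin
          (inter_mem self_mem_nhdsWithin (mem_nhdsWithin_of_mem_nhds (isOpen_ne.mem_nhds hz₀)))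
      fun_prop
  have hint : (∮ z in C(0, ρ), z ^ (-m - 1) • f z) = 0 := by
    simpa only [hj, zpow_natCast, pow_add, mul_smul] using
      (hdiff.mono closure_ball_subset_closedBall).diffContOnCl.circleIntegral_eq_zero hρ.le
  rw [laurentCoeff, hint, smul_zero]

theorem hasDerivAt_laurentCoeff [CompleteSpace E] {U : Set ℂ} (hU : IsOpen U) (hρ : 0 < ρ)
    {f : ℂ → ℂ → E} (hf : ContinuousOn (Function.uncurry fun z t => f t z) (sphere 0 ρ ×ˢ U))
    (hd : ∀ z ∈ sphere (0 : ℂ) ρ, DifferentiableOn ℂ (fun t => f t z) U) (m : ℤ) {t : ℂ}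
    (ht : t ∈ U) :
    HasDerivAt (fun τ => laurentCoeff ρ (f τ) m)
      (laurentCoeff ρ (fun z => deriv (fun τ => f τ z) t) m) t := by
  have hmem : ∀ θ : ℝ, circleMap 0 ρ θ ∈ sphere (0 : ℂ) ρ := circleMap_mem_sphere 0 hρ.le
  have hweight : Continuous fun θ => deriv (circleMap 0 ρ) θ • circleMap 0 ρ θ ^ (-m - 1) := by
    simp only [deriv_circleMap]
    exact (by fun_prop : Continuous fun θ => circleMap 0 ρ θ * Complex.I).smul
      ((continuous_circleMap 0 ρ).zpow₀ _ fun θ => .inl (circleMap_ne_center hρ.ne'))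
  have hintegral : HasDerivAt (fun τ => ∮ z in C(0, ρ), z ^ (-m - 1) • f τ z)
      (∮ z in C(0, ρ), z ^ (-m - 1) • deriv (fun τ => f τ z) t) t := by
    have h := hasDerivAt_intervalIntegral_of_differentiableOn hU (a := 0) (b := 2 * Real.pi)
      (F := fun τ θ => deriv (circleMap 0 ρ) θ • circleMap 0 ρ θ ^ (-m - 1) •
        f τ (circleMap 0 ρ θ)) ?_
      (fun θ _ => ((hd _ (hmem θ)).fun_const_smul _).fun_const_smul _) ht
    · refine h.congr_deriv (intervalIntegral.integral_congr fun θ _ => ?_)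
      have hθ := (hd _ (hmem θ)).hasDerivAt (hU.mem_nhds ht)
      exact ((hθ.const_smul (circleMap 0 ρ θ ^ (-m - 1))).const_smul _).deriv
    · simp only [← smul_assoc]
      exact (hweight.comp continuous_fst).continuousOn.smul
        (hf.comp (f := fun q : ℝ × ℂ => (circleMap 0 ρ q.1, q.2)) (by fun_prop)
          fun q hq => ⟨hmem q.1, hq.2⟩)
  exact hintegral.const_smul _

theorem differentiableOn_iteratedDeriv [CompleteSpace E] {U : Set ℂ} (hU : IsOpen U)
    (hf : DifferentiableOn ℂ f U) (i : ℕ) : DifferentiableOn ℂ (iteratedDeriv i f) U := by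
  induction i with
  | zero => simpa using hf
  | succ i ih => rw [iteratedDeriv_succ]; exact ih.deriv hU

theorem continuousOn_iteratedDeriv_prod [CompleteSpace E] {U V : Set ℂ} (hU : IsOpen U)
    {f : ℂ → ℂ → E} (hf : DifferentiableOn ℂ (fun p : ℂ × ℂ => f p.1 p.2) (U ×ˢ V)) (i : ℕ) :
    ContinuousOn (Function.uncurry fun w z => iteratedDeriv i (fun ζ => f ζ w) z) (V ×ˢ U) := by
  induction i with
  | zero =>
    simp only [iteratedDeriv_zero]
    exact hf.continuousOn.comp continuous_swap.continuousOn fun p hp => ⟨hp.2, hp.1⟩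
  | succ i ih =>
    simp only [iteratedDeriv_succ]
    exact continuousOn_deriv_of_continuousOn_uncurry hU ih fun w hw =>
      differentiableOn_iteratedDeriv hU (differentiableOn_slice_left hf hw) i

section HolomorphicFamily

variable [CompleteSpace E] {U V : Set ℂ} {f : ℂ → ℂ → E} (hU : IsOpen U) (hρ : 0 < ρ)
  (hρV : sphere 0 ρ ⊆ V) (hf : DifferentiableOn ℂ (fun p : ℂ × ℂ => f p.1 p.2) (U ×ˢ V)) (m : ℤ)
include hU hρ hρV hf

theorem hasDerivAt_laurentCoeff_iteratedDeriv (i : ℕ) {t : ℂ} (ht : t ∈ U) :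
    HasDerivAt (fun τ => laurentCoeff ρ (fun z => iteratedDeriv i (fun τ => f τ z) τ) m)
      (laurentCoeff ρ (fun z => iteratedDeriv (i + 1) (fun τ => f τ z) t) m) t := by
  simp only [iteratedDeriv_succ]
  exact hasDerivAt_laurentCoeff hU hρ
    (f := fun τ z => iteratedDeriv i (fun τ => f τ z) τ)
    ((continuousOn_iteratedDeriv_prod hU hf i).mono (prod_mono_left hρV))
    (fun z hz => differentiableOn_iteratedDeriv hU (differentiableOn_slice_left hf (hρV hz)) i) m ht

theorem differentiableOn_laurentCoeff :
    DifferentiableOn ℂ (fun t => laurentCoeff ρ (f t) m) U := fun t ht => by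
  have h := hasDerivAt_laurentCoeff_iteratedDeriv hU hρ hρV hf m 0 ht
  simp only [iteratedDeriv_zero] at h
  exact h.differentiableAt.differentiableWithinAt

theorem iteratedDeriv_laurentCoeff (i : ℕ) : EqOn (iteratedDeriv i fun t => laurentCoeff ρ (f t) m)
    (fun t => laurentCoeff ρ (fun z => iteratedDeriv i (fun τ => f τ z) t) m) U := by
  induction i with
  | zero => exact fun t _ => by simp only [iteratedDeriv_zero]
  | succ i ih =>
    intro t ht
    rw [iteratedDeriv_succ]
    exact (ih.eventuallyEq_of_mem (hU.mem_nhds ht)).deriv_eq.trans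
      (hasDerivAt_laurentCoeff_iteratedDeriv hU hρ hρV hf m i ht).deriv

theorem iteratedDeriv_laurentCoeff_of_forall_eq (i : ℕ) {t : ℂ} (ht : t ∈ U) {c : E}
    (hc : ∀ z ∈ V, iteratedDeriv i (fun τ => f τ z) t = c) :
    iteratedDeriv i (fun τ => laurentCoeff ρ (f τ) m) t = if m = 0 then c else 0 := by
  rw [iteratedDeriv_laurentCoeff hU hρ hρV hf m i ht, ← laurentCoeff_const hρ]
  exact laurentCoeff_congr hρ.le (fun z hz => hc z (hρV hz)) m

theorem laurentCoeff_iteratedDeriv_eq_zero (hm : ∀ t ∈ U, laurentCoeff ρ (f t) m = 0) (i : ℕ)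
    {t : ℂ} (ht : t ∈ U) : laurentCoeff ρ (fun z => iteratedDeriv i (fun τ => f τ z) t) m = 0 := by
  have hzero : (fun τ => laurentCoeff ρ (f τ) m) =ᶠ[𝓝 t] fun _ => 0 :=
    EqOn.eventuallyEq_of_mem hm (hU.mem_nhds ht)
  refine (iteratedDeriv_laurentCoeff hU hρ hρV hf m i ht).symm.trans ?_
  rw [hzero.iteratedDeriv_eq i, iteratedDeriv_const, ite_self]

end HolomorphicFamily

end LaurentCoeff

section SingularPerturbation

open Set Metric

variable {n s : ℕ} {a : Fin n → ℂ → ℂ → ℂ} {U W : Set ℂ} {y : ℂ → ℂ → ℂ}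

theorem exists_leading_coeff_ne_zero (h : ∃ k, ∃ t ∈ U, a k t 0 ≠ 0) :
    ∃ m, (∃ t ∈ U, a m t 0 ≠ 0) ∧ ∀ i, m < i → ∀ t ∈ U, a i t 0 = 0 := by
  obtain ⟨m, hm, hmax⟩ :=
    (Set.toFinite {k : Fin n | ∃ t ∈ U, a k t 0 ≠ 0}).exists_maximal h
  refine ⟨m, hm, fun i hi t ht => ?_⟩
  by_contra hne
  exact hi.not_ge (hmax ⟨t, ht, hne⟩ hi.le)

theorem sphere_subset_sdiff_singleton {ρ R : ℝ} (hρ : 0 < ρ) (hρR : ρ < R)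
    (hRW : closedBall 0 R ⊆ W) : sphere 0 ρ ⊆ W \ {0} := fun _ hz =>
  ⟨hRW (closedBall_subset_closedBall hρR.le (sphere_subset_closedBall hz)),
    ne_of_mem_sphere hz hρ.ne'⟩

namespace IsParamSolution

section LaurentCoeff

variable {ρ R : ℝ} (hU : IsOpen U) (hρ : 0 < ρ) (hρR : ρ < R) (hRW : closedBall 0 R ⊆ W)
  (hs : 1 ≤ s) (ha : ∀ i, DifferentiableOn ℂ (fun p : ℂ × ℂ => a i p.1 p.2) (U ×ˢ W))
  (hy : IsParamSolution s a U (W \ {0}) y)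
include hU hρ hρR hRW hs ha hy

theorem sum_mul_iteratedDeriv_laurentCoeff_eq_zero {m : ℤ}
    (hm : ∀ k < m, ∀ t ∈ U, laurentCoeff ρ (y t) k = 0) {t : ℂ} (ht : t ∈ U) :
    ∑ i : Fin n, a i t 0 * iteratedDeriv i (fun τ => laurentCoeff ρ (y τ) m) t = 0 := by
  have hsphere := sphere_subset_sdiff_singleton hρ hρR hRW
  let d : ℕ → ℂ → ℂ := fun i z => iteratedDeriv i (fun τ => y τ z) t
  have hd : ∀ i, ContinuousOn (d i) (sphere 0 ρ) := fun i =>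
    (continuousOn_iteratedDeriv_prod hU hy.holomorphic i).comp (f := fun z => (z, t))
      (by fun_prop) fun z hz => ⟨hsphere hz, ht⟩
  have hlow : ∀ i, ∀ k < m, laurentCoeff ρ (d i) k = 0 := fun i k hk =>
    laurentCoeff_iteratedDeriv_eq_zero hU hρ hsphere hy.holomorphic k (hm k hk) i ht
  have hslice : ∀ i, DifferentiableOn ℂ (a i t) W := fun i => differentiableOn_slice_right (ha i) ht
  have hterm : ∀ i, ContinuousOn (fun z => a i t z • d i z) (sphere 0 ρ) := fun i =>
    ((hslice i).continuousOn.mono (hsphere.trans sdiff_subset)).smul (hd i)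
  have hcoeff : ∀ i : Fin n, laurentCoeff ρ (fun z => a i t z • d i z) m =
      a i t 0 * iteratedDeriv i (fun τ => laurentCoeff ρ (y τ) m) t := fun i => by
    rw [iteratedDeriv_laurentCoeff hU hρ hsphere hy.holomorphic m i ht]
    have hp := ((hslice i).mono ((Real.coe_toNNReal R (hρ.trans hρR).le).symm ▸ hRW))
      |>.hasFPowerSeriesOnBall (R := R.toNNReal) (Real.toNNReal_pos.2 (hρ.trans hρR))
    exact laurentCoeff_smul_of_forall_lt hρ
      ((ENNReal.ofReal_lt_ofReal_iff (hρ.trans hρR)).2 hρR) hp (hd i) (hlow i)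
  -- The highest derivative only contributes through coefficients of order less than `m`.
  have htop : laurentCoeff ρ (fun z => z ^ (s : ℤ) • d n z) m = 0 :=
    (laurentCoeff_zpow_smul hρ _ _ _).trans (hlow n _ (by omega))
  have hequation : laurentCoeff ρ (fun z => z ^ (s : ℤ) • d n z + ∑ i, a i t z • d i z) m = 0 := by
    rw [laurentCoeff_congr hρ.le (g := fun _ => 0) (fun z hz => ?_), laurentCoeff_const hρ,
      ite_self]
    simpa using hy.equation t ht z (hsphere hz)
  rw [laurentCoeff_add hρ (continuousOn_zpow_smul_sphere hρ (hd n) s)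
    (continuousOn_finsetSum _ fun i _ => hterm i), htop, zero_add,
    laurentCoeff_sum _ hρ fun i _ => hterm i] at hequation
  exact (Finset.sum_congr rfl fun i _ => hcoeff i).symm.trans hequation

variable (hU' : IsPreconnected U) {t₀ : ℂ} (ht₀ : t₀ ∈ U) {m : Fin n} (hm : a m t₀ 0 ≠ 0)
  (hgt : ∀ i, m < i → ∀ t ∈ U, a i t 0 = 0) {c : Fin n → ℂ}
  (hc : ∀ ε ∈ W \ {0}, ∀ i : Fin n, iteratedDeriv i (fun t => y t ε) t₀ = c i)
include hU' ht₀ hm hgt hc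

theorem laurentCoeff_eq_zero_of_forall_lt {k : ℤ} (hk : k ≠ 0)
    (hlow : ∀ j < k, ∀ t ∈ U, laurentCoeff ρ (y t) j = 0) {t : ℂ} (ht : t ∈ U) :
    laurentCoeff ρ (y t) k = 0 := by
  have hsphere := sphere_subset_sdiff_singleton hρ hρR hRW
  have h0 : (0 : ℂ) ∈ W := hRW (mem_closedBall_self (hρ.trans hρR).le)
  have hu : AnalyticOnNhd ℂ (fun t => laurentCoeff ρ (y t) k) U :=
    (differentiableOn_laurentCoeff hU hρ hsphere hy.holomorphic k).analyticOnNhd hU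
  have hlocal : (fun t => laurentCoeff ρ (y t) k) =ᶠ[𝓝 t₀] 0 :=
    eventually_eq_zero_of_linear_ode (b := fun i t => a i t 0) (hu t₀ ht₀)
      (fun i => (differentiableOn_slice_left (ha i) h0).analyticAt (hU.mem_nhds ht₀)) hm
      (fun i hi => EqOn.eventuallyEq_of_mem (hgt i hi) (hU.mem_nhds ht₀))
      (by
        filter_upwards [hU.mem_nhds ht₀] with τ hτ using
          sum_mul_iteratedDeriv_laurentCoeff_eq_zero hU hρ hρR hRW hs ha hy hlow hτ)
      (fun i hi => by
        rw [iteratedDeriv_laurentCoeff_of_forall_eq hU hρ hsphere hy.holomorphic k i ht₀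
          fun ε hε => hc ε hε ⟨i, hi.trans m.2⟩, if_neg hk])
  exact hu.eqOn_zero_of_preconnected_of_eventuallyEq_zero hU' ht₀ hlocal ht

theorem exists_lt_laurentCoeff_ne_zero (hac : ∑ i, a i t₀ 0 * c i ≠ 0) (N : ℤ) :
    ∃ k < N, ∃ t ∈ U, laurentCoeff ρ (y t) k ≠ 0 := by
  by_contra! hN
  have hneg : ∀ k < 0, ∀ t ∈ U, laurentCoeff ρ (y t) k = 0 := by
    by_contra! hex
    obtain ⟨k, ⟨hk, t, ht, hne⟩, hmin⟩ := Int.exists_least_of_bdd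
      (P := fun k => k < 0 ∧ ∃ t ∈ U, laurentCoeff ρ (y t) k ≠ 0)
      ⟨N, fun k ⟨_, t, ht, hne⟩ => not_lt.1 fun hkN => hne (hN k hkN t ht)⟩ hex
    refine hne (laurentCoeff_eq_zero_of_forall_lt hU hρ hρR hRW hs ha hy hU' ht₀ hm hgt hc hk.ne
      (fun j hj τ hτ => ?_) ht)
    by_contra hne'
    exact hj.not_ge (hmin j ⟨hj.trans hk, τ, hτ, hne'⟩)
  refine hac ?_
  have hlimit := sum_mul_iteratedDeriv_laurentCoeff_eq_zero hU hρ hρR hRW hs ha hy hneg ht₀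
  simpa only [iteratedDeriv_laurentCoeff_of_forall_eq hU hρ
    (sphere_subset_sdiff_singleton hρ hρR hRW) hy.holomorphic 0 _ ht₀ fun ε hε => hc ε hε _,
    if_true] using hlimit

end LaurentCoeff

theorem countable_setOf_meromorphicAt (hU : IsOpen U) (hU' : IsPreconnected U) (hW : IsOpen W)
    (h0 : (0 : ℂ) ∈ W) (ha : IsSingularlyPerturbed s a U W)
    (hy : IsParamSolution s a U (W \ {0}) y) {t₀ : ℂ} (ht₀ : t₀ ∈ U) {m : Fin n}
    (hm : a m t₀ 0 ≠ 0) (hgt : ∀ i, m < i → ∀ t ∈ U, a i t 0 = 0) {c : Fin n → ℂ}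
    (hc : ∀ ε ∈ W \ {0}, ∀ i : Fin n, iteratedDeriv i (fun t => y t ε) t₀ = c i)
    (hac : ∑ i, a i t₀ 0 * c i ≠ 0) : {t ∈ U | MeromorphicAt (y t) 0}.Countable := by
  obtain ⟨R, hR, hRW⟩ := nhds_basis_closedBall.mem_iff.1 (hW.mem_nhds h0)
  obtain ⟨ρ, hρ, hρR⟩ := exists_between hR
  choose k hkN hne using
    exists_lt_laurentCoeff_ne_zero hU hρ hρR hRW ha.one_le ha.holomorphic hy hU' ht₀ hm hgt hc hac
  refine (countable_iUnion fun N => countable_zeros hU hU'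
    (differentiableOn_laurentCoeff hU hρ (sphere_subset_sdiff_singleton hρ hρR hRW)
      hy.holomorphic (k N)) (hne N)).mono ?_
  rintro t ⟨ht, hmer⟩
  have hpunctured : closedBall 0 ρ \ {0} ⊆ W \ {0} :=
    sdiff_subset_sdiff_left ((closedBall_subset_closedBall hρR.le).trans hRW)
  obtain ⟨N, hN⟩ := exists_forall_lt_laurentCoeff_eq_zero hρ
    ((differentiableOn_slice_right hy.holomorphic ht).mono hpunctured) hmer
  exact mem_iUnion.2 ⟨N, ht, hN _ (hkN N)⟩

theorem hasEssentialSingularityAt (hW : IsOpen W) (h0 : (0 : ℂ) ∈ W)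
    (hy : IsParamSolution s a U (W \ {0}) y) {t : ℂ} (ht : t ∈ U)
    (hmer : ¬ MeromorphicAt (y t) 0) : HasEssentialSingularityAt (y t) 0 := by
  refine ⟨?_, hmer⟩
  filter_upwards [nhdsWithin_le_nhds (hW.mem_nhds h0), self_mem_nhdsWithin] with z hz hz₀
  exact (differentiableOn_slice_right hy.holomorphic ht).differentiableAt
    ((hW.sdiff isClosed_singleton).mem_nhds ⟨hz, hz₀⟩)

end IsParamSolution

end SingularPerturbation

theorem lemma4p1_general {n s : ℕ} {a : Fin n → ℂ → ℂ → ℂ} {U W : Set ℂ} (hU : IsOpen U)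
    (hU' : Convex ℝ U) (hW : IsOpen W) (h0 : (0 : ℂ) ∈ W) (ha : IsSingularlyPerturbed s a U W) :
    ∃ D : Set ℂ, D ⊆ U ∧ (∀ t ∈ U, ¬ AccPt t (𝓟 D)) ∧
      ∀ t₀ ∈ U \ D, ∃ y : ℂ → ℂ → ℂ, IsParamSolution s a U (W \ {0}) y ∧
        (∃ c : Fin n → ℂ, ∀ ε ∈ W \ {0}, ∀ i : Fin n,
          iteratedDeriv (i : ℕ) (fun t => y t ε) t₀ = c i) ∧
        ∃ E : Set ℂ, E ⊆ U ∧ E.Countable ∧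
          ∀ t₁ ∈ U \ E, HasEssentialSingularityAt (fun ε => y t₁ ε) 0 := by
  obtain ⟨m, hne, hgt⟩ := exists_leading_coeff_ne_zero ha.exists_ne_zero
  refine ⟨{t ∈ U | a m t 0 = 0}, Set.sep_subset _ _, not_accPt_zeros hU hU'.isPreconnected
    (differentiableOn_slice_left (ha.holomorphic m) h0) hne, ?_⟩
  rintro t₀ ⟨ht₀, hD⟩
  have hm : a m t₀ 0 ≠ 0 := fun h => hD ⟨ht₀, h⟩
  obtain ⟨y, hy, hc⟩ := exists_isParamSolution (s := s) hU (hU'.starConvex ht₀)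
    (hW.sdiff isClosed_singleton) (fun ε hε => hε.2)
    (fun i => (ha.holomorphic i).mono (Set.prod_mono_right Set.sdiff_subset)) ht₀ (Pi.single m 1)
  have hac : ∑ i, a i t₀ 0 * (Pi.single m 1 : Fin n → ℂ) i ≠ 0 := by
    simpa [Pi.single_apply] using hm
  exact ⟨y, hy, ⟨_, hc⟩, {t ∈ U | MeromorphicAt (y t) 0}, Set.sep_subset _ _,
    hy.countable_setOf_meromorphicAt hU hU'.isPreconnected hW h0 ha ht₀ hm hgt hc hac,
    fun t₁ ht₁ => hy.hasEssentialSingularityAt hW h0 ht₁.1 fun hmer => ht₁.2 ⟨ht₁.1, hmer⟩⟩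

theorem lemma4p1 (n s : ℕ) (a : Fin n → ℂ → ℂ → ℂ) (cU cW : ℂ) (rU rW : ℝ)
    (h0 : (0 : ℂ) ∈ Metric.ball cW rW)
    (ha : IsSingularlyPerturbed s a (Metric.ball cU rU) (Metric.ball cW rW)) :
    ∃ D : Set ℂ, D ⊆ Metric.ball cU rU ∧ (∀ t ∈ Metric.ball cU rU, ¬ AccPt t (𝓟 D)) ∧
      ∀ t₀ ∈ Metric.ball cU rU \ D, ∃ y : ℂ → ℂ → ℂ,
        IsParamSolution s a (Metric.ball cU rU) (Metric.ball cW rW \ {0}) y ∧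
        (∃ c : Fin n → ℂ, ∀ ε ∈ Metric.ball cW rW \ {0}, ∀ i : Fin n,
          iteratedDeriv (i : ℕ) (fun t => y t ε) t₀ = c i) ∧
        ∃ E : Set ℂ, E ⊆ Metric.ball cU rU ∧ E.Countable ∧
          ∀ t₁ ∈ Metric.ball cU rU \ E, HasEssentialSingularityAt (fun ε => y t₁ ε) 0 :=
  lemma4p1_general Metric.isOpen_ball (convex_ball cU rU) Metric.isOpen_ball h0 ha
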